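/- Let $X$ be a path connected, locally path connected, semilocally simply connected, locally compact Hausdorff topological group. Let $\Pi_1(X)$ be its fundamental groupoid: an arrow is an endpoint-fixing homotopy class $[\gamma]$ of a path $\gamma$ in $X$, with source $s([\gamma])=\gamma(0)$ and range $r([\gamma])=\gamma(1)$, and the product of two arrows is induced by concatenation of paths (the right factor first); give $\Pi_1(X)$ the quotient topology of the compact-open topology on the space of all paths in $X$. Then $\Pi_1(X)$ is a locally compact Hausdorff topological groupoid with unit space $X$, and it has a Haar system, that is, a family $(\alpha^x)_{x\in X}$ of positive Radon measures on $\Pi_1(X)$, along the continuous open surjection $r\colon\Pi_1(X)\to X$, such that 1. for every $x\in X$, $\alpha^x$ is concentrated on $r^{-1}(x)$ and its support is all of $r^{-1}(x)$; 2. for every $f\in C_c(\Pi_1(X))$ the function $x\mapsto\int f\,d\alpha^x$ belongs to $C_c(X)$; 3. for every $f\in C_c(\Pi_1(X))$ and every $\gamma\in\Pi_1(X)$, $$\int f(\gamma\eta)\,d\alpha^{s(\gamma)}(\eta)=\int f(\eta)\,d\alpha^{r(\gamma)}(\eta).$$ Moreover, a Haar system is obtained from a Haar measure on the universal covering group. There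 is a universal covering group $p\colon H\to X$ (a simply connected topological group $H$, which is locally compact and Hausdorff, with a surjective group homomorphism $p$ that is a covering map). Let $H$ act on $X$ by $h\cdot x=p(h)x$, and let $H\ltimes X$ be the transformation groupoid: its arrow space is $H\times X$, the arrow $(h,x)$ has source $x$ and range $h\cdot x$, and $(k,h\cdot x)(h,x)=(kh,x)$. Then there is an isomorphism of topological groupoids $\Phi\colon H\ltimes X\to\Pi_1(X)$ that is the identity on the unit space $X$, such that for every left Haar measure $\lambda$ on $H$ (a regular Borel measure) the measures $$\alpha^y=\text{ the image of }\lambda\text{ under } h\mapsto\Phi(h,\,h^{-1}\cdot y),\qquad y\in X,$$ form a Haar system on $\Pi_1(X)$. -/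

import Mathlib

open CategoryTheory MeasureTheory Topology
open scoped CompactlySupported

universe u

noncomputable section

namespace TopGpd

/-! ### Groupoids and their arrows

A groupoid is a small category `C` all of whose morphisms are invertible; `Arr C` is the set of all
its arrows. The product `γ η` of arrows is defined when the source of `γ` is the range of `η`
(arrows are directed from right to left), that is, it is the categorical composite
"first `η`, then `γ`". -/

section Groupoid

variable (C : Type*) [Groupoid C]

/-- The set of all arrows of the groupoid `C`. -/
abbrev Arr : Type _ := Quiver.Total C

variable {C}

/-- The source of an arrow. -/
def arrSource (γ : Arr C) : C := γ.left

/-- The range of an arrow. -/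
def arrRange (γ : Arr C) : C := γ.right

/-- The unit (identity arrow) at an object. -/
def arrUnit (x : C) : Arr C := ⟨x, x, 𝟙 x⟩

/-- The inverse arrow. -/
def arrInv (γ : Arr C) : Arr C := ⟨γ.right, γ.left, Groupoid.inv γ.hom⟩

/-- The product `γ η`, defined when the source of `γ` is the range of `η`. -/
def arrMul (γ η : Arr C) (h : arrSource γ = arrRange η) : Arr C :=
  ⟨η.left, γ.right, η.hom ≫ eqToHom h.symm ≫ γ.hom⟩

/-- The map induced by a functor on the sets of arrows. -/
def arrMap {D : Type*} [Groupoid D] (F : C ⥤ D) (γ : Arr C) : Arr D :=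
  ⟨F.obj γ.left, F.obj γ.right, F.map γ.hom⟩

/-- The family of functions in the translation formula for Haar systems: `η ↦ f (γ η)` on the
range fibre over the source of `γ`, extended by zero to all arrows. -/
def leftTranslate (f : Arr C → ℂ) (γ : Arr C) (η : Arr C) : ℂ :=
  open Classical in if h : arrSource γ = arrRange η then f (arrMul γ η h) else 0

end Groupoid

/-! ### Topological groupoids -/

section Topological

variable (C : Type*) [Groupoid C] [TopologicalSpace C] [TopologicalSpace (Arr C)]

/-- A topological groupoid: source, range, inversion and multiplication are continuous, and the
topology of the space of units is the subspace topology. -/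
structure IsTopologicalGroupoid : Prop where
  isEmbedding_unit : IsEmbedding (arrUnit : C → Arr C)
  continuous_source : Continuous (arrSource : Arr C → C)
  continuous_range : Continuous (arrRange : Arr C → C)
  continuous_inv : Continuous (arrInv : Arr C → Arr C)
  continuous_mul : Continuous
    (fun p : {p : Arr C × Arr C // arrSource p.1 = arrRange p.2} => arrMul p.1.1 p.1.2 p.2)

/-- A locally compact groupoid: a topological groupoid whose arrow space is locally compact and
whose space of units is Hausdorff. -/
structure IsLocallyCompactGroupoid : Prop extends IsTopologicalGroupoid C where
  locallyCompact_arr : LocallyCompactSpace (Arr C)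
  t2_units : T2Space C

variable {C}

/-- A functor is an isomorphism of topological groupoids if it is a homeomorphism on the spaces of
units and on the spaces of arrows. -/
structure IsTopologicalIso {D : Type*} [Groupoid D] [TopologicalSpace D] [TopologicalSpace (Arr D)]
    (F : C ⥤ D) : Prop where
  isHomeomorph_obj : IsHomeomorph F.obj
  isHomeomorph_arr : IsHomeomorph (arrMap F)

end Topological

/-! ### Families of measures and Haar systems -/

/-- A continuous family of (Radon) measures `μ = (μ_y)` along a continuous open surjection
`π : Z → Y`: each `μ_y` is a Radon measure concentrated on the fibre `π⁻¹(y)`, and for every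
`f ∈ C_c(Z)` the function `y ↦ ∫ f dμ_y` is in `C_c(Y)`. -/
structure IsContinuousFamily {Z Y : Type*} [TopologicalSpace Z] [TopologicalSpace Y]
    [MeasurableSpace Z] [BorelSpace Z] (π : Z → Y) (μ : Y → Measure Z) : Prop where
  continuous_map : Continuous π
  isOpenMap_map : IsOpenMap π
  surjective_map : Function.Surjective π
  regular : ∀ y, (μ y).Regular
  null_compl_fibre : ∀ y, μ y (π ⁻¹' {y})ᶜ = 0
  continuous_integral : ∀ f : C_c(Z, ℂ), Continuous fun y => ∫ z, f z ∂(μ y)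
  hasCompactSupport_integral : ∀ f : C_c(Z, ℂ), HasCompactSupport fun y => ∫ z, f z ∂(μ y)

/-- A Haar system on a topological groupoid: a continuous family of measures along the range map,
each measure having the whole range fibre as its support, which is invariant under left
multiplication: `∫ f(γ η) dα^{s(γ)}(η) = ∫ f(η) dα^{r(γ)}(η)`. -/
structure IsHaarSystem {C : Type*} [Groupoid C] [TopologicalSpace C] [TopologicalSpace (Arr C)]
    [MeasurableSpace (Arr C)] [BorelSpace (Arr C)] (α : C → Measure (Arr C)) : Prop
    extends IsContinuousFamily (arrRange : Arr C → C) α where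
  support_eq : ∀ x, (α x).support = arrRange ⁻¹' {x}
  left_invariant : ∀ (f : C_c(Arr C, ℂ)) (γ : Arr C),
    ∫ η, leftTranslate f γ η ∂(α (arrSource γ)) = ∫ η, f η ∂(α (arrRange γ))

/-! ### The fundamental groupoid as a topological groupoid -/

section Fundamental

variable (X : Type*) [TopologicalSpace X]

/-- The class in the fundamental groupoid of an arbitrary path in `X`, as an arrow from its initial
point to its end point. -/
def pathClass (γ : C(unitInterval, X)) : Arr (FundamentalGroupoid X) :=
  ⟨⟨γ 0⟩, ⟨γ 1⟩, Path.Homotopic.Quotient.mk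
    (⟨γ, rfl, rfl⟩ : Path (γ 0) (γ 1))⟩

/-- The space of units of the fundamental groupoid is `X`. -/
instance : TopologicalSpace (FundamentalGroupoid X) :=
  TopologicalSpace.induced FundamentalGroupoid.as inferInstance

/-- The fundamental groupoid carries the quotient topology of the compact-open topology on the
space of all paths. -/
instance : TopologicalSpace (Arr (FundamentalGroupoid X)) :=
  TopologicalSpace.coinduced (pathClass X) inferInstance

instance : MeasurableSpace (Arr (FundamentalGroupoid X)) := borel _

instance : BorelSpace (Arr (FundamentalGroupoid X)) := ⟨rfl⟩

/-- Semilocally simply connected: every point has an open neighbourhood `U` such that each loop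
in `U` at the point is null-homotopic in `X`. -/
def SemilocallySimplyConnected : Prop :=
  ∀ x : X, ∃ U : Set X, IsOpen U ∧ x ∈ U ∧
    ∀ γ : Path x x, Set.range γ ⊆ U → γ.Homotopic (Path.refl x)

end Fundamental

/-! ### The transformation groupoid of a group action

`ActionCategory H X` is the transformation groupoid `H ⋉ X`: its objects are the points of `X` and
its arrows from `x` to `y` are the `h ∈ H` with `h • x = y`. -/

section Transformation

variable (H X : Type*) [Group H] [MulAction H X] [TopologicalSpace H] [TopologicalSpace X]

instance : TopologicalSpace (ActionCategory H X) :=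
  TopologicalSpace.induced ActionCategory.back inferInstance

/-- The arrow space of `H ⋉ X` is topologised as the product `H × X`, an arrow being given by its
label in `H` and its source in `X`. -/
instance : TopologicalSpace (Arr (ActionCategory H X)) :=
  TopologicalSpace.induced
    (fun γ : Arr (ActionCategory H X) => ((γ.hom.val, γ.left.back) : H × X)) inferInstance

instance : MeasurableSpace (Arr (ActionCategory H X)) := borel _

instance : BorelSpace (Arr (ActionCategory H X)) := ⟨rfl⟩

variable {H X}

/-- The family of measures on `H ⋉ X` induced by a measure `lam` on `H`: the measure over the unit
`y` is the image of `lam` under the bijection `h ↦ (h : h⁻¹ • y ⟶ y)` of `H` with the range fibre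
over `y`. -/
def transformationFamily [MeasurableSpace H] (lam : Measure H) (y : X) :
    Measure (Arr (ActionCategory H X)) :=
  lam.map fun h => ⟨((h⁻¹ • y : X) : ActionCategory H X), (y : ActionCategory H X),
    ActionCategory.homOfPair y h⟩

end Transformation

/-- `p : H → X` is a universal covering group of the topological group `X`: `H` is a simply
connected topological group and `p` is a group homomorphism and a covering map. -/
structure IsUniversalCoveringGroup {H X : Type*} [Group H] [TopologicalSpace H]
    [Group X] [TopologicalSpace X] (p : H →* X) : Prop where
  isTopologicalGroup : IsTopologicalGroup H
  simplyConnected : SimplyConnectedSpace H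
  isCoveringMap : IsCoveringMap p
  surjective : Function.Surjective p

end TopGpd

end

open TopGpd

open TopGpd

namespace TopGpd

/-! ### Push-forward of measures along closed embeddings -/

section PushForward

variable {Y Z : Type*} [TopologicalSpace Y] [MeasurableSpace Y] [BorelSpace Y]
  [TopologicalSpace Z] [MeasurableSpace Z] [BorelSpace Z]

/-! The group structure of `X` straightens the path space. Each path `δ` is uniquely `t ↦ γ t * x`
with `γ` a path starting at `1` and `x = δ 0`, so `C(I, X)` is homeomorphic to `basedPaths X × X`
(`pathHomeomorph`). Based paths form a topological group under pointwise multiplication, and two of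
them are homotopic rel end points exactly when they lie in one coset of the normal subgroup
`nullLoops X` (`mk_eq_mk_iff`). Passing to quotients identifies the arrows of the fundamental
groupoid with `H × X`, where `H = basedPaths X ⧸ nullLoops X`. Concatenation becomes the product of
`H` by an Eckmann–Hilton argument (`arrowClass_comp`), which yields the isomorphism `comparison`.

The end point map `H → X` is an open surjective homomorphism with discrete kernel, hence a covering.
Initial segments of based paths give explicit lifts, which show that `H` is simply connected.

On `H ⋉ X` every range fibre is a copy of `H` on which arrows act by left translation. A Haar
measure on `H`, copied to each fibre, is therefore a Haar system
(`isHaarSystem_transformationFamily`), and `IsTopologicalIso.isHaarSystem` carries it across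
`comparison`. -/

theorem regular_map_of_isClosedEmbedding {g : Y → Z} (hg : IsClosedEmbedding g)
    (μ : Measure Y) [μ.Regular] : (μ.map g).Regular := by
  have hme := hg.measurableEmbedding
  have : IsFiniteMeasureOnCompacts (μ.map g) := ⟨fun K hK => by
    rw [hme.map_apply]
    exact (hg.isCompact_preimage hK).measure_lt_top⟩
  have : (μ.map g).OuterRegular := ⟨fun A _ r hr => by
    rw [hme.map_apply] at hr
    obtain ⟨U, hAU, hU, hUr⟩ := (g ⁻¹' A).exists_isOpen_lt_of_lt r hr
    obtain ⟨V, hV, rfl⟩ := hg.isOpen_iff.1 hU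
    -- `A` need not lie in the range of `g`. Adding the complement of the range, which is open and
    -- null for the image measure, covers the rest of `A` at no cost.
    refine ⟨V ∪ (Set.range g)ᶜ, fun z hz => ?_, hV.union hg.isClosed_range.isOpen_compl, ?_⟩
    · by_cases hzr : z ∈ Set.range g
      · obtain ⟨y, rfl⟩ := hzr
        exact Or.inl (hAU hz)
      · exact Or.inr hzr
    · rw [hme.map_apply]
      refine lt_of_eq_of_lt (congrArg μ ?_) hUr
      ext y
      simp⟩
  refine ⟨fun U hU r hr => ?_⟩
  rw [hme.map_apply] at hr
  obtain ⟨K, hKU, hK, hrK⟩ := (hU.preimage hg.continuous).exists_lt_isCompact hr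
  refine ⟨g '' K, Set.image_subset_iff.2 hKU, hK.image hg.continuous, ?_⟩
  rwa [hme.map_apply, Set.preimage_image_eq _ hme.injective]

theorem support_map_of_isClosedEmbedding {g : Y → Z} (hg : IsClosedEmbedding g)
    (μ : Measure Y) : (μ.map g).support = g '' μ.support := by
  have hme := hg.measurableEmbedding
  ext z
  rw [Measure.mem_support_iff_forall]
  constructor
  · intro h
    by_cases hz : z ∈ Set.range g
    · obtain ⟨y, rfl⟩ := hz
      refine ⟨y, (Measure.mem_support_iff_forall y).2 fun U hU => ?_, rfl⟩
      rw [hg.nhds_eq_comap] at hU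
      obtain ⟨V, hV, hVU⟩ := hU
      have := h V hV
      rw [hme.map_apply] at this
      exact this.trans_le (measure_mono hVU)
    · have := h _ (hg.isClosed_range.isOpen_compl.mem_nhds hz)
      rw [hme.map_apply] at this
      simp at this
  · rintro ⟨y, hy, rfl⟩ U hU
    rw [hme.map_apply]
    exact (Measure.mem_support_iff_forall y).1 hy _ (hg.continuous.continuousAt hU)

end PushForward

/-! ### Transport along isomorphisms of topological groupoids -/

section Transport

variable {C D : Type*} [Groupoid C] [Groupoid D]

theorem arrMul_mk {x y z : C} (g : y ⟶ z) (k : x ⟶ y) :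
    arrMul (⟨y, z, g⟩ : Arr C) ⟨x, y, k⟩ rfl = ⟨x, z, k ≫ g⟩ := by
  change (⟨x, z, k ≫ 𝟙 y ≫ g⟩ : Arr C) = _
  rw [Category.id_comp]

theorem arrMap_arrMul (F : C ⥤ D) (γ η : Arr C) (h : arrSource γ = arrRange η) :
    arrMap F (arrMul γ η h) = arrMul (arrMap F γ) (arrMap F η) (congrArg F.obj h) := by
  obtain ⟨x, y, g⟩ := γ
  obtain ⟨z, w, k⟩ := η
  change x = w at h
  subst h
  rw [arrMul_mk]
  change _ = arrMul (⟨F.obj x, F.obj y, F.map g⟩ : Arr D) ⟨F.obj z, F.obj x, F.map k⟩ rfl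
  rw [arrMul_mk, arrMap, F.map_comp]

theorem arrMap_arrInv (F : C ⥤ D) (γ : Arr C) : arrMap F (arrInv γ) = arrInv (arrMap F γ) := by
  simp [arrInv, arrMap]

theorem arrMap_arrUnit (F : C ⥤ D) (x : C) : arrMap F (arrUnit x) = arrUnit (F.obj x) := by
  simp [arrUnit, arrMap]

variable [TopologicalSpace C] [TopologicalSpace (Arr C)] [TopologicalSpace D]
  [TopologicalSpace (Arr D)] {F : C ⥤ D}

theorem IsTopologicalIso.isLocallyCompactGroupoid (hF : IsTopologicalIso F)
    (hC : IsLocallyCompactGroupoid C) : IsLocallyCompactGroupoid D := by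
  obtain ⟨e₀, he₀⟩ := isHomeomorph_iff_exists_homeomorph.1 hF.isHomeomorph_obj
  obtain ⟨e, he⟩ := isHomeomorph_iff_exists_homeomorph.1 hF.isHomeomorph_arr
  have hsymm₀ (y : D) : F.obj (e₀.symm y) = y := by rw [← he₀, e₀.apply_symm_apply]
  have hsymm (γ : Arr D) : arrMap F (e.symm γ) = γ := by rw [← he, e.apply_symm_apply]
  have hsource : (arrSource : Arr D → D) = e₀ ∘ arrSource ∘ e.symm := by
    funext γ
    conv_lhs => rw [← hsymm γ]
    simp [he₀, arrMap, arrSource]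
  have hrange : (arrRange : Arr D → D) = e₀ ∘ arrRange ∘ e.symm := by
    funext γ
    conv_lhs => rw [← hsymm γ]
    simp [he₀, arrMap, arrRange]
  have hinv : (arrInv : Arr D → Arr D) = e ∘ arrInv ∘ e.symm := by
    funext γ
    conv_lhs => rw [← hsymm γ]
    simp [he, arrMap_arrInv]
  have hunit : (arrUnit : D → Arr D) = e ∘ arrUnit ∘ e₀.symm := by
    funext y
    conv_lhs => rw [← hsymm₀ y]
    simp [he, arrMap_arrUnit]
  have hsr (p : {p : Arr D × Arr D // arrSource p.1 = arrRange p.2}) :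
      arrSource (e.symm p.1.1) = arrRange (e.symm p.1.2) := by
    exact e₀.injective
      ((congrFun hsource p.1.1).symm.trans (p.2.trans (congrFun hrange p.1.2)))
  refine
    { isEmbedding_unit := ?_
      continuous_source := ?_
      continuous_range := ?_
      continuous_inv := ?_
      continuous_mul := ?_
      locallyCompact_arr := ?_
      t2_units := ?_ }
  · rw [hunit]
    exact e.isEmbedding.comp (hC.isEmbedding_unit.comp e₀.symm.isEmbedding)
  · rw [hsource]
    exact e₀.continuous.comp (hC.continuous_source.comp e.symm.continuous)
  · rw [hrange]
    exact e₀.continuous.comp (hC.continuous_range.comp e.symm.continuous)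
  · rw [hinv]
    exact e.continuous.comp (hC.continuous_inv.comp e.symm.continuous)
  · have hmul : (fun p : {p : Arr D × Arr D // arrSource p.1 = arrRange p.2} =>
        arrMul p.1.1 p.1.2 p.2) = e ∘ (fun p : {p : Arr C × Arr C // arrSource p.1 = arrRange p.2} =>
        arrMul p.1.1 p.1.2 p.2) ∘ fun p => ⟨(e.symm p.1.1, e.symm p.1.2), hsr p⟩ := by
      funext p
      simp only [Function.comp_apply, he, arrMap_arrMul, hsymm]
    rw [hmul]
    refine e.continuous.comp (hC.continuous_mul.comp (Continuous.subtype_mk ?_ _))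
    fun_prop
  · have := hC.locallyCompact_arr
    exact e.symm.isClosedEmbedding.locallyCompactSpace
  · have := hC.t2_units
    exact e₀.symm.isEmbedding.t2Space

/-- Injectivity on objects matters here: without it non-composable arrows could become composable,
and the extensions by zero would disagree. -/
theorem leftTranslate_arrMap (hF : IsTopologicalIso F) (f : Arr D → ℂ) (γ η : Arr C) :
    leftTranslate f (arrMap F γ) (arrMap F η) = leftTranslate (f ∘ arrMap F) γ η := by
  have hiff : arrSource (arrMap F γ) = arrRange (arrMap F η) ↔ arrSource γ = arrRange η :=
    hF.isHomeomorph_obj.injective.eq_iff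
  unfold leftTranslate
  by_cases h : arrSource γ = arrRange η
  · rw [dif_pos h, dif_pos (hiff.2 h), Function.comp_apply, arrMap_arrMul]
  · rw [dif_neg h, dif_neg (mt hiff.1 h)]

variable [MeasurableSpace (Arr C)] [BorelSpace (Arr C)] [MeasurableSpace (Arr D)]
  [BorelSpace (Arr D)]

/-- Prescribing `β` at the objects `F.obj x` determines it, since `F` is bijective on objects; each
axiom is then the one for `α` read through the two homeomorphisms. -/
theorem IsTopologicalIso.isHaarSystem (hF : IsTopologicalIso F) {α : C → Measure (Arr C)}
    (hα : IsHaarSystem α) {β : D → Measure (Arr D)}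
    (hβ : ∀ x, β (F.obj x) = (α x).map (arrMap F)) : IsHaarSystem β := by
  obtain ⟨e₀, he₀⟩ := isHomeomorph_iff_exists_homeomorph.1 hF.isHomeomorph_obj
  obtain ⟨e, he⟩ := isHomeomorph_iff_exists_homeomorph.1 hF.isHomeomorph_arr
  rw [← he] at hβ
  have hsymm (γ : Arr D) : arrMap F (e.symm γ) = γ := by rw [← he, e.apply_symm_apply]
  have hrange_e (γ : Arr C) : arrRange (e γ) = F.obj (arrRange γ) := by rw [he]; rfl
  have hsource_e (γ : Arr C) : arrSource (e γ) = F.obj (arrSource γ) := by rw [he]; rfl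
  have hrange : (arrRange : Arr D → D) = e₀ ∘ arrRange ∘ e.symm := by
    funext γ
    conv_lhs => rw [← hsymm γ]
    simp [he₀, arrMap, arrRange]
  have hβ' (y : D) : β y = (α (e₀.symm y)).map e := by
    rw [← hβ, ← he₀, e₀.apply_symm_apply]
  have hfibre (x : C) : e ⁻¹' (arrRange ⁻¹' {F.obj x}) = arrRange ⁻¹' {x} := by
    ext γ
    simp [hrange_e, hF.isHomeomorph_obj.injective.eq_iff]
  have hint (y : D) (f : Arr D → ℂ) : ∫ η, f η ∂(β y) = ∫ η, f (e η) ∂(α (e₀.symm y)) := by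
    rw [hβ', e.measurableEmbedding.integral_map]
  let pull (f : C_c(Arr D, ℂ)) : C_c(Arr C, ℂ) :=
    ⟨⟨f ∘ e, f.continuous.comp e.continuous⟩,
      f.hasCompactSupport.comp_isClosedEmbedding e.isClosedEmbedding⟩
  have hpull (f : C_c(Arr D, ℂ)) :
      (fun y => ∫ η, f η ∂(β y)) = (fun x => ∫ η, pull f η ∂(α x)) ∘ e₀.symm := by
    funext y
    exact hint y f
  refine
    { continuous_map := ?_
      isOpenMap_map := ?_
      surjective_map := ?_
      regular := fun y => ?_
      null_compl_fibre := fun y => ?_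
      continuous_integral := fun f => ?_
      hasCompactSupport_integral := fun f => ?_
      support_eq := fun y => ?_
      left_invariant := fun f γ => ?_ }
  · rw [hrange]
    exact e₀.continuous.comp (hα.continuous_map.comp e.symm.continuous)
  · rw [hrange]
    exact e₀.isOpenMap.comp (hα.isOpenMap_map.comp e.symm.isOpenMap)
  · rw [hrange]
    exact e₀.surjective.comp (hα.surjective_map.comp e.symm.surjective)
  · rw [hβ']
    have := hα.regular (e₀.symm y)
    exact Measure.Regular.map e
  · obtain ⟨x, rfl⟩ := hF.isHomeomorph_obj.surjective y
    rw [hβ, e.measurableEmbedding.map_apply, Set.preimage_compl, hfibre]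
    exact hα.null_compl_fibre x
  · rw [hpull]
    exact (hα.continuous_integral _).comp e₀.symm.continuous
  · rw [hpull]
    exact (hα.hasCompactSupport_integral _).comp_isClosedEmbedding e₀.symm.isClosedEmbedding
  · obtain ⟨x, rfl⟩ := hF.isHomeomorph_obj.surjective y
    rw [hβ, support_map_of_isClosedEmbedding e.isClosedEmbedding, hα.support_eq, ← hfibre,
      e.image_preimage]
  · obtain ⟨γ, rfl⟩ := e.surjective γ
    rw [hsource_e, hrange_e, hβ, hβ, e.measurableEmbedding.integral_map,
      e.measurableEmbedding.integral_map]
    simp only [he, leftTranslate_arrMap hF]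
    have := hα.left_invariant (pull f) γ
    simpa [pull, he, Function.comp_def] using this

end Transport

/-! ### The transformation groupoid is a locally compact groupoid with a Haar system -/

section TransformationGroupoid

variable {H X : Type*} [Group H] [MulAction H X]

/-- The arrow of `H ⋉ X` with a given label and source. -/
def transformationArr (h : H) (x : X) : Arr (ActionCategory H X) :=
  ⟨(x : ActionCategory H X), ((h • x : X) : ActionCategory H X), ⟨h, rfl⟩⟩

/-- The label in `H` of an arrow of `H ⋉ X`. -/
def arrLabel (γ : Arr (ActionCategory H X)) : H := γ.hom.val

theorem transformationArr_ext {γ η : Arr (ActionCategory H X)}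
    (hlabel : arrLabel γ = arrLabel η) (hleft : γ.left.back = η.left.back) : γ = η := by
  obtain ⟨⟨⟨⟩, (x : X)⟩, ⟨⟨⟩, (y : X)⟩, ⟨(g : H), (hg : g • x = y)⟩⟩ := γ
  obtain ⟨⟨⟨⟩, (x' : X)⟩, ⟨⟨⟩, (y' : X)⟩, ⟨(g' : H), (hg' : g' • x' = y')⟩⟩ := η
  change g = g' at hlabel
  change x = x' at hleft
  subst hlabel hleft hg hg'
  rfl

/-- The action category arrow space is in bijection with `H × X`. -/
def transformationEquiv : Arr (ActionCategory H X) ≃ H × X where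
  toFun γ := (arrLabel γ, γ.left.back)
  invFun p := transformationArr p.1 p.2
  left_inv _ := transformationArr_ext rfl rfl
  right_inv _ := rfl

theorem label_smul_source (γ : Arr (ActionCategory H X)) :
    arrLabel γ • γ.left.back = γ.right.back := Subtype.property γ.hom

theorem label_arrMul (γ η : Arr (ActionCategory H X)) (h : arrSource γ = arrRange η) :
    arrLabel (arrMul γ η h) = arrLabel γ * arrLabel η := by
  obtain ⟨x, y, g⟩ := γ
  obtain ⟨z, w, k⟩ := η
  change x = w at h
  subst h
  rw [arrMul_mk]
  rfl

/-- The arrow with range `y` and label `h`. -/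
def transformationArrTo (y : X) (h : H) : Arr (ActionCategory H X) :=
  ⟨((h⁻¹ • y : X) : ActionCategory H X), (y : ActionCategory H X), ActionCategory.homOfPair y h⟩

/-- The source of invariance: with range fibres parametrised by labels, multiplication by `γ` is
left translation by the label of `γ`. -/
theorem arrMul_transformationArrTo (γ : Arr (ActionCategory H X)) (h : H)
    (hγ : arrSource γ = arrRange (transformationArrTo (arrSource γ).back h)) :
    arrMul γ (transformationArrTo (arrSource γ).back h) hγ =
      transformationArrTo (arrRange γ).back (arrLabel γ * h) := by
  refine transformationArr_ext (label_arrMul _ _ _) ?_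
  change h⁻¹ • γ.left.back = (arrLabel γ * h)⁻¹ • γ.right.back
  rw [← label_smul_source γ, mul_inv_rev, mul_smul, inv_smul_smul]

theorem range_transformationArrTo (x : ActionCategory H X) :
    Set.range (transformationArrTo (H := H) x.back) = arrRange ⁻¹' {x} := by
  ext γ
  constructor
  · rintro ⟨h, rfl⟩
    exact ActionCategory.back_coe x
  · intro hγ
    refine ⟨arrLabel γ, transformationArr_ext rfl ?_⟩
    change (arrLabel γ)⁻¹ • x.back = γ.left.back
    have : γ.right = x := hγ
    rw [inv_smul_eq_iff, label_smul_source, this]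

variable [TopologicalSpace X]

/-- The unit space of `H ⋉ X` is homeomorphic to `X`. -/
def unitHomeomorph : ActionCategory H X ≃ₜ X :=
  (ActionCategory.objEquiv H X).symm.toHomeomorphOfIsInducing ⟨rfl⟩

theorem continuous_units_iff {T : Type*} [TopologicalSpace T] {g : T → ActionCategory H X} :
    Continuous g ↔ Continuous fun t => (g t).back :=
  unitHomeomorph.comp_continuous_iff.symm

variable [TopologicalSpace H]

/-- The arrow space of `H ⋉ X` is homeomorphic to `H × X`. -/
def transformationHomeomorph : Arr (ActionCategory H X) ≃ₜ H × X :=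
  transformationEquiv.toHomeomorphOfIsInducing ⟨rfl⟩

theorem continuous_transformation_iff {T : Type*} [TopologicalSpace T]
    {g : T → Arr (ActionCategory H X)} :
    Continuous g ↔ Continuous (fun t => arrLabel (g t)) ∧ Continuous fun t => (g t).left.back := by
  rw [← transformationHomeomorph.comp_continuous_iff, continuous_prodMk.symm]
  rfl

theorem continuous_label : Continuous fun γ : Arr (ActionCategory H X) => arrLabel γ :=
  (continuous_transformation_iff.1 continuous_id).1

theorem continuous_source_back : Continuous fun γ : Arr (ActionCategory H X) => γ.left.back :=
  (continuous_transformation_iff.1 continuous_id).2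

variable [ContinuousSMul H X]

theorem continuous_range_back : Continuous fun γ : Arr (ActionCategory H X) => γ.right.back := by
  simp_rw [← label_smul_source]
  exact continuous_label.smul continuous_source_back

variable [IsTopologicalGroup H]

theorem isTopologicalGroupoid_actionCategory :
    IsTopologicalGroupoid (ActionCategory H X) where
  isEmbedding_unit := by
    refine IsEmbedding.of_leftInverse (f := arrSource) (fun _ => rfl) ?_ ?_
    · exact continuous_units_iff.2 continuous_source_back
    · exact continuous_transformation_iff.2
        ⟨continuous_const (y := (1 : H)), continuous_units_iff.1 continuous_id⟩
  continuous_source := continuous_units_iff.2 continuous_source_back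
  continuous_range := continuous_units_iff.2 continuous_range_back
  continuous_inv := continuous_transformation_iff.2 ⟨continuous_label.inv, continuous_range_back⟩
  continuous_mul := by
    refine continuous_transformation_iff.2 ⟨?_, ?_⟩
    · simp_rw [label_arrMul]
      exact (continuous_label.comp (continuous_fst.comp continuous_subtype_val)).mul
        (continuous_label.comp (continuous_snd.comp continuous_subtype_val))
    · change Continuous ((fun γ : Arr (ActionCategory H X) => γ.left.back) ∘ fun p :
        {p : Arr (ActionCategory H X) × Arr (ActionCategory H X) //
          arrSource p.1 = arrRange p.2} => p.1.2)
      exact continuous_source_back.comp (continuous_snd.comp continuous_subtype_val)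

theorem isLocallyCompactGroupoid_actionCategory [LocallyCompactSpace H] [LocallyCompactSpace X]
    [T2Space X] : IsLocallyCompactGroupoid (ActionCategory H X) where
  toIsTopologicalGroupoid := isTopologicalGroupoid_actionCategory
  locallyCompact_arr := transformationHomeomorph.isClosedEmbedding.locallyCompactSpace
  t2_units := unitHomeomorph.isEmbedding.t2Space

/-- The range map is the source map after inversion; the former is a product projection, the latter
a homeomorphism. -/
theorem isOpenMap_arrRange :
    IsOpenMap (arrRange : Arr (ActionCategory H X) → ActionCategory H X) := by
  have hs : IsOpenMap (arrSource : Arr (ActionCategory H X) → ActionCategory H X) :=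
    unitHomeomorph.symm.isOpenMap.comp (isOpenMap_snd.comp transformationHomeomorph.isOpenMap)
  have hinv : Function.Involutive (arrInv : Arr (ActionCategory H X) → Arr (ActionCategory H X)) :=
    fun γ => transformationArr_ext (inv_inv (arrLabel γ)) rfl
  have hc := (isTopologicalGroupoid_actionCategory (H := H) (X := X)).continuous_inv
  exact hs.comp (Homeomorph.mk hinv.toPerm hc hc).isOpenMap

/-- The label is a continuous left inverse, and a continuous section into a Hausdorff space has
closed range. -/
theorem isClosedEmbedding_transformationArrTo [T2Space H] [T2Space X] (y : X) :
    IsClosedEmbedding (transformationArrTo (H := H) y) := by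
  have : T2Space (Arr (ActionCategory H X)) := transformationHomeomorph.isEmbedding.t2Space
  refine Function.LeftInverse.isClosedEmbedding (f := fun γ => arrLabel γ) (fun _ => rfl)
    continuous_label (continuous_transformation_iff.2 ⟨continuous_id, ?_⟩)
  exact continuous_inv.smul continuous_const

variable [MeasurableSpace H] [BorelSpace H]

theorem integral_transformationFamily [T2Space H] [T2Space X] (lam : Measure H) (y : X)
    (f : Arr (ActionCategory H X) → ℂ) :
    ∫ η, f η ∂(transformationFamily lam y) = ∫ h, f (transformationArrTo y h) ∂lam :=
  (isClosedEmbedding_transformationArrTo y).measurableEmbedding.integral_map f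

theorem isHaarSystem_transformationFamily [T2Space H] [T2Space X] (lam : Measure H)
    [lam.IsHaarMeasure] [lam.Regular] :
    IsHaarSystem fun x : ActionCategory H X => transformationFamily lam x.back where
  continuous_map := isTopologicalGroupoid_actionCategory.continuous_range
  isOpenMap_map := isOpenMap_arrRange
  surjective_map x := ⟨arrUnit x, rfl⟩
  regular x := regular_map_of_isClosedEmbedding (isClosedEmbedding_transformationArrTo x.back) lam
  null_compl_fibre x := by
    change lam.map (transformationArrTo x.back) _ = 0
    rw [(isClosedEmbedding_transformationArrTo x.back).measurableEmbedding.map_apply]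
    convert! measure_empty (μ := lam)
    ext h
    simp [transformationArrTo, arrRange]
  continuous_integral f := by
    simp_rw [integral_transformationFamily]
    refine Continuous.comp (g := fun y : X => ∫ h, f (transformationArrTo y h) ∂lam) ?_
      unitHomeomorph.continuous
    rw [← continuousOn_univ]
    -- The labels occurring in the support of `f` form one compact set that contains the support of
    -- the integrand for every `y`.
    refine continuousOn_integral_of_compact_support
      (k := (fun γ : Arr (ActionCategory H X) => arrLabel γ) '' tsupport f)
      (f.hasCompactSupport.isCompact.image continuous_label) ?_ ?_
    · refine (f.continuous.comp (continuous_transformation_iff.2 ⟨?_, ?_⟩)).continuousOn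
      · exact continuous_snd
      · exact continuous_snd.inv.smul continuous_fst
    · intro y h _ hh
      by_contra hne
      exact hh ⟨transformationArrTo y h, subset_tsupport _ hne, rfl⟩
  hasCompactSupport_integral f := by
    have : T2Space (ActionCategory H X) := unitHomeomorph.isEmbedding.t2Space
    refine HasCompactSupport.intro (f.hasCompactSupport.isCompact.image
      isTopologicalGroupoid_actionCategory.continuous_range) fun x hx => ?_
    rw [integral_transformationFamily]
    refine integral_eq_zero_of_ae (Filter.Eventually.of_forall fun h => ?_)
    by_contra hne
    exact hx ⟨transformationArrTo x.back h, subset_tsupport _ hne, rfl⟩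
  support_eq x := by
    change (lam.map (transformationArrTo x.back)).support = _
    rw [support_map_of_isClosedEmbedding (isClosedEmbedding_transformationArrTo x.back),
      Measure.support_eq_univ, Set.image_univ, range_transformationArrTo]
  left_invariant f γ := by
    rw [integral_transformationFamily, integral_transformationFamily,
      ← integral_mul_left_eq_self (fun h => f (transformationArrTo (arrRange γ).back h))
        (arrLabel γ)]
    refine integral_congr_ae (Filter.Eventually.of_forall fun h => ?_)
    have hγ : arrSource γ = arrRange (transformationArrTo (arrSource γ).back h) :=
      (ActionCategory.back_coe _).symm
    change leftTranslate f γ (transformationArrTo (arrSource γ).back h) = _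
    rw [leftTranslate, dif_pos hγ, arrMul_transformationArrTo]

end TransformationGroupoid

open unitInterval

/-! ### The universal covering group -/

section UniversalCover

/-- Neighbourhoods of the constant path contain all paths with small range. -/
theorem exists_range_subset_of_mem_nhds_one {X : Type*} [One X] [TopologicalSpace X]
    {W : Set C(I, X)} (hW : W ∈ 𝓝 (1 : C(I, X))) :
    ∃ V ∈ 𝓝 (1 : X), ∀ γ : C(I, X), Set.range γ ⊆ V → γ ∈ W := by
  have hmono : Monotone fun V : Set X => {γ : C(I, X) | Set.range γ ⊆ V} :=
    fun V V' hV γ (hγ : Set.range γ ⊆ V) => hγ.trans hV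
  have hlim : Filter.Tendsto id
      ((𝓝 (1 : X)).lift' fun V => {γ : C(I, X) | Set.range γ ⊆ V}) (𝓝 (1 : C(I, X))) := by
    refine ContinuousMap.tendsto_nhds_compactOpen.2 fun K _ U hU hKU => ?_
    -- For empty `K` the set `U` need not contain `1`, but the condition on paths is vacuous.
    obtain rfl | ⟨t, ht⟩ := K.eq_empty_or_nonempty
    · exact Filter.Eventually.of_forall fun _ => Set.mapsTo_empty _ _
    · have h1 : (1 : X) ∈ U := hKU ht
      filter_upwards [Filter.mem_lift' (hU.mem_nhds h1)] with γ hγ s _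
      exact hγ ⟨s, rfl⟩
  obtain ⟨V, hV, hVW⟩ := (Filter.mem_lift'_sets hmono).1 (hlim hW)
  exact ⟨V, hV, fun γ hγ => hVW hγ⟩

variable (X : Type*) [Group X] [TopologicalSpace X] [IsTopologicalGroup X]

instance : IsTopologicalGroup C(I, X) where
  continuous_inv := ContinuousMap.continuous_postcomp (⟨Inv.inv, continuous_inv⟩ : C(X, X))

/-- The group of paths starting at the identity, under pointwise multiplication. -/
def basedPaths : Subgroup C(I, X) where
  carrier := {γ | γ 0 = 1}
  mul_mem' {γ δ} (hγ : γ 0 = 1) (hδ : δ 0 = 1) := by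
    change γ 0 * δ 0 = 1
    rw [hγ, hδ, one_mul]
  one_mem' := rfl
  inv_mem' {γ} (hγ : γ 0 = 1) := by
    change (γ 0)⁻¹ = 1
    rw [hγ, inv_one]

variable {X}

theorem basedPaths_zero (γ : basedPaths X) : (γ : C(I, X)) 0 = 1 := γ.2

/-- Homotopies multiply pointwise. No condition is imposed on the values at `S`, so loops may be
multiplied by paths that are not loops, as in the conjugations that make `nullLoops` normal. -/
theorem HomotopicRel.mul {γ γ' δ δ' : C(I, X)} {S : Set I} (h : γ.HomotopicRel γ' S)
    (h' : δ.HomotopicRel δ' S) : (γ * δ).HomotopicRel (γ' * δ') S :=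
  h.elim fun F => h'.elim fun G =>
    ⟨(ContinuousMap.HomotopyRel.prod F G).compContinuousMap
      (⟨fun p => p.1 * p.2, continuous_mul⟩ : C(X × X, X))⟩

variable (X)

/-- The subgroup of null-homotopic loops at the identity. -/
def nullLoops : Subgroup (basedPaths X) where
  carrier := {γ | (γ : C(I, X)).HomotopicRel 1 {0, 1}}
  mul_mem' {γ δ} hγ hδ := by
    have := HomotopicRel.mul hγ hδ
    rwa [one_mul] at this
  one_mem' := .refl _
  inv_mem' {γ} (hγ : (γ : C(I, X)).HomotopicRel 1 {0, 1}) := by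
    have := HomotopicRel.mul (.refl (γ : C(I, X))⁻¹) hγ
    rw [inv_mul_cancel, mul_one] at this
    exact this.symm

instance : (nullLoops X).Normal where
  conj_mem γ (hγ : (γ : C(I, X)).HomotopicRel 1 {0, 1}) δ := by
    have := HomotopicRel.mul (HomotopicRel.mul (.refl (δ : C(I, X))) hγ) (.refl (δ : C(I, X))⁻¹)
    rwa [mul_one, mul_inv_cancel] at this

/-- The universal covering group: homotopy classes of paths starting at the identity. -/
abbrev UniversalCover : Type _ := basedPaths X ⧸ nullLoops X

/-- Evaluation of a based path at its end point. -/
def endPoint : basedPaths X →* X where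
  toFun γ := (γ : C(I, X)) 1
  map_one' := rfl
  map_mul' _ _ := rfl

/-- The projection of the universal covering group. -/
def coverProj : UniversalCover X →* X :=
  QuotientGroup.lift (nullLoops X) (endPoint X) fun _ hγ =>
    ContinuousMap.HomotopicRel.fst_eq_snd hγ (Or.inr rfl)

variable {X}

theorem coverProj_mk (γ : basedPaths X) : coverProj X (γ : UniversalCover X) = (γ : C(I, X)) 1 :=
  rfl

/-- Multiplying a homotopy by the constant homotopy of `γ` or of its inverse passes between the two
sides. -/
theorem mk_eq_mk_iff {γ δ : basedPaths X} :
    (γ : UniversalCover X) = δ ↔ (γ : C(I, X)).HomotopicRel δ {0, 1} := by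
  rw [QuotientGroup.eq]
  change ((γ : C(I, X))⁻¹ * δ).HomotopicRel 1 {0, 1} ↔ _
  constructor
  · intro h
    have := HomotopicRel.mul (.refl (γ : C(I, X))) h
    rw [mul_inv_cancel_left, mul_one] at this
    exact this.symm
  · intro h
    have := HomotopicRel.mul (.refl (γ : C(I, X))⁻¹) h
    rw [inv_mul_cancel] at this
    exact this.symm

theorem continuous_endPoint : Continuous (endPoint X) :=
  (continuous_eval_const (1 : I)).comp continuous_subtype_val

theorem continuous_coverProj : Continuous (coverProj X) :=
  continuous_endPoint.quotient_lift _

/-- For a homomorphism only neighbourhoods of `1` matter. A point in the path component of `1` in a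
small `V` is the end of a path inside `V`, and such a path is close to the constant one. -/
theorem isOpenMap_endPoint [LocallyPathConnectedSpace X] : IsOpenMap (endPoint X) := by
  refine IsTopologicalGroup.isOpenMap_iff_nhds_one.2 fun S hS => ?_
  rw [nhds_subtype_eq_comap] at hS
  obtain ⟨W, hW, hWS⟩ := hS
  obtain ⟨V, hV, hVW⟩ := exists_range_subset_of_mem_nhds_one hW
  refine Filter.mem_of_superset (pathComponentIn_mem_nhds hV) fun x hx => ?_
  obtain ⟨γ, hγ⟩ := hx
  have := @hWS ⟨γ, γ.source⟩ (hVW γ (Set.range_subset_iff.2 hγ))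
  rw [Set.mem_preimage] at this
  rwa [← γ.target]

theorem surjective_coverProj [PathConnectedSpace X] : Function.Surjective (coverProj X) := by
  intro x
  obtain ⟨γ⟩ := PathConnectedSpace.joined (1 : X) x
  exact ⟨((⟨γ, γ.source⟩ : basedPaths X) : UniversalCover X), γ.target⟩

theorem isOpenMap_coverProj [LocallyPathConnectedSpace X] : IsOpenMap (coverProj X) :=
  IsOpenMap.of_comp continuous_quotient_mk' QuotientGroup.mk_surjective isOpenMap_endPoint

/-- Classes of based paths inside `U` form an open set, because the quotient map is open. It meets
the kernel only in `1`, as loops in `U` at `1` are null-homotopic. -/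
theorem isDiscrete_ker_coverProj (hX : SemilocallySimplyConnected X) :
    IsDiscrete ((coverProj X).ker : Set (UniversalCover X)) := by
  obtain ⟨U, hU, h1, hnull⟩ := hX 1
  rw [isDiscrete_iff_discreteTopology]
  refine discreteTopology_of_isOpen_singleton_one (G := (coverProj X).ker) ?_
  let O : Set (basedPaths X) := {γ | Set.range (γ : C(I, X)) ⊆ U}
  have hO : IsOpen O :=
    (ContinuousMap.isOpen_setOfPred_range_subset hU).preimage continuous_subtype_val
  convert! (QuotientGroup.isOpenMap_coe (N := nullLoops X) O hO).preimage
    (continuous_subtype_val (p := fun h => h ∈ (coverProj X).ker))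
  ext ⟨h, hh⟩
  simp only [Set.mem_singleton_iff, Set.mem_preimage, Set.mem_image]
  constructor
  · intro h1'
    refine ⟨1, ?_, (congrArg Subtype.val h1').symm⟩
    rintro _ ⟨t, rfl⟩
    exact h1
  · rintro ⟨γ, hγ, rfl⟩
    have h0 : (γ : C(I, X)) 0 = 1 := γ.2
    exact Subtype.ext ((QuotientGroup.eq_one_iff γ).2
      (hnull ⟨γ, h0, hh⟩ hγ))

theorem isCoveringMap_coverProj [PathConnectedSpace X] [LocallyPathConnectedSpace X]
    (hX : SemilocallySimplyConnected X) : IsCoveringMap (coverProj X) :=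
  (IsQuotientMap.isQuotientCoveringMap_of_isDiscrete_ker_monoidHom
    (isOpenMap_coverProj.isQuotientMap continuous_coverProj surjective_coverProj)
    (isDiscrete_ker_coverProj hX)).isCoveringMap

/-- The initial segments of a based path, as a path in the space of based paths. -/
def initialPaths (γ : basedPaths X) : C(I, basedPaths X) where
  toFun s := ⟨(⟨fun p : I × I => (γ : C(I, X)) (p.1 * p.2), by fun_prop⟩ : C(I × I, X)).curry s, by
    change (γ : C(I, X)) (s * 0) = 1
    rw [mul_zero, basedPaths_zero]⟩
  continuous_toFun := Continuous.subtype_mk (ContinuousMap.continuous _) _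

theorem initialPaths_zero (γ : basedPaths X) : initialPaths γ 0 = 1 := by
  ext t
  change (γ : C(I, X)) (0 * t) = 1
  rw [zero_mul, basedPaths_zero]

theorem initialPaths_one (γ : basedPaths X) : initialPaths γ 1 = γ := by
  ext t
  change (γ : C(I, X)) (1 * t) = _
  rw [one_mul]

theorem coverProj_initialPaths (γ : basedPaths X) (s : I) :
    coverProj X (initialPaths γ s : UniversalCover X) = (γ : C(I, X)) s := by
  change (γ : C(I, X)) (s * 1) = _
  rw [mul_one]

theorem pathConnectedSpace_universalCover : PathConnectedSpace (UniversalCover X) := by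
  have h1 (h : UniversalCover X) : Joined 1 h := by
    obtain ⟨γ, rfl⟩ := QuotientGroup.mk_surjective h
    exact ⟨⟨⟨fun s => (initialPaths γ s : UniversalCover X),
      continuous_quotient_mk'.comp (initialPaths γ).continuous⟩,
      congrArg _ (initialPaths_zero γ), congrArg _ (initialPaths_one γ)⟩⟩
  exact ⟨⟨1⟩, fun g h => (h1 g).symm.trans (h1 h)⟩

/-- Project a loop `τ` at `h` and translate it to a path `γ` based at `1`. Both `τ` and `h` times
the classes of the initial segments of `γ` lift the projected loop from `h`, so they agree. At time
`1` this reads `h = h * [γ]`; thus `γ` is null-homotopic, and so is the projected loop. That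
homotopy lifts. -/
theorem simplyConnectedSpace_universalCover [PathConnectedSpace X] [LocallyPathConnectedSpace X]
    (hX : SemilocallySimplyConnected X) : SimplyConnectedSpace (UniversalCover X) := by
  have hcov := isCoveringMap_coverProj hX
  refine simply_connected_iff_loops_nullhomotopic.2
    ⟨pathConnectedSpace_universalCover, fun h τ => ?_⟩
  have hc : Continuous fun s => (coverProj X h)⁻¹ * coverProj X (τ s) :=
    continuous_const.mul (continuous_coverProj.comp τ.continuous)
  let γ : basedPaths X := ⟨⟨_, hc⟩, by
    change (coverProj X h)⁻¹ * coverProj X (τ 0) = 1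
    rw [τ.source, inv_mul_cancel]⟩
  have hγ (s : I) : coverProj X h * (γ : C(I, X)) s = coverProj X (τ s) :=
    mul_inv_cancel_left _ _
  have hlift : (fun s => τ s) = fun s => h * (initialPaths γ s : UniversalCover X) := by
    refine hcov.eq_of_comp_eq τ.continuous (continuous_const.mul
      (continuous_quotient_mk'.comp (initialPaths γ).continuous)) ?_ 0 ?_
    · funext s
      change coverProj X (τ s) = coverProj X (h * (initialPaths γ s : UniversalCover X))
      rw [map_mul, coverProj_initialPaths, hγ]
    · rw [initialPaths_zero, τ.source, QuotientGroup.mk_one, mul_one]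
  have hone : (γ : UniversalCover X) = 1 := by
    have := congrFun hlift 1
    simp only [τ.target, initialPaths_one] at this
    exact (mul_eq_left.1 this.symm)
  have hnull : (γ : C(I, X)).HomotopicRel 1 {0, 1} := (QuotientGroup.eq_one_iff γ).1 hone
  refine (hcov.homotopicRel_iff_comp (f₀ := (τ : C(I, UniversalCover X)))
    (f₁ := (Path.refl h : C(I, UniversalCover X))) ⟨0, Or.inl rfl, τ.source⟩).2 ?_
  have := HomotopicRel.mul (.refl (ContinuousMap.const I (coverProj X h))) hnull
  convert! this using 1
  · ext s
    exact (hγ s).symm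
  · ext s
    exact (mul_one (coverProj X h)).symm

/-- Points of one fibre are separated because a covering map is separated, other points by their
images in `X`. -/
theorem t2Space_universalCover [T2Space X] [PathConnectedSpace X] [LocallyPathConnectedSpace X]
    (hX : SemilocallySimplyConnected X) : T2Space (UniversalCover X) := by
  refine ⟨fun g h hgh => ?_⟩
  by_cases hp : coverProj X g = coverProj X h
  · exact (isCoveringMap_coverProj hX).isSeparatedMap g h hp hgh
  · obtain ⟨U, V, hU, hV, hgU, hhV, hUV⟩ := t2_separation hp
    exact ⟨_, _, hU.preimage continuous_coverProj, hV.preimage continuous_coverProj, hgU, hhV,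
      hUV.preimage _⟩

theorem locallyCompactSpace_universalCover [LocallyCompactSpace X] [PathConnectedSpace X]
    [LocallyPathConnectedSpace X] (hX : SemilocallySimplyConnected X) :
    LocallyCompactSpace (UniversalCover X) := by
  refine ⟨fun h n hn => ?_⟩
  obtain ⟨e, he, hep⟩ := (isCoveringMap_coverProj hX).isLocalHomeomorph h
  obtain ⟨K, hK, hKn, hKc⟩ := LocallyCompactSpace.local_compact_nhds (e h) (e.target ∩ e.symm ⁻¹' n)
    (Filter.inter_mem (e.open_target.mem_nhds (e.map_source he))
      ((e.continuousAt_symm (e.map_source he)).preimage_mem_nhds (by rwa [e.left_inv he])))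
  refine ⟨e.symm '' K, ?_, ?_, ?_⟩
  · rw [← e.left_inv he]
    exact e.symm.image_mem_nhds (e.map_source he) hK
  · rintro _ ⟨x, hx, rfl⟩
    exact (hKn hx).2
  · exact hKc.image_of_continuousOn (e.continuousOn_symm.mono fun x hx => (hKn hx).1)

theorem isUniversalCoveringGroup_coverProj [PathConnectedSpace X] [LocallyPathConnectedSpace X]
    (hX : SemilocallySimplyConnected X) : IsUniversalCoveringGroup (coverProj X) where
  isTopologicalGroup := inferInstance
  simplyConnected := simplyConnectedSpace_universalCover hX
  isCoveringMap := isCoveringMap_coverProj hX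
  surjective := surjective_coverProj

end UniversalCover

/-! ### Comparison with the fundamental groupoid -/

section Comparison

/-- `pathClass` fixes the end points as `γ 0` and `γ 1`; this removes the dependence on equal but
not syntactically identical ones. -/
theorem arr_mk_eq_pathClass {X : Type*} [TopologicalSpace X] {x y : X} (γ : Path x y) :
    (⟨⟨x⟩, ⟨y⟩, Path.Homotopic.Quotient.mk γ⟩ : Arr (FundamentalGroupoid X)) = pathClass X γ := by
  obtain ⟨γ, hx, hy⟩ := γ
  subst hx hy
  rfl

theorem pathClass_surjective (X : Type*) [TopologicalSpace X] :
    Function.Surjective (pathClass X) := by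
  rintro ⟨⟨x⟩, ⟨y⟩, g⟩
  obtain ⟨γ, rfl⟩ := Path.Homotopic.Quotient.mk_surjective g
  exact ⟨_, (arr_mk_eq_pathClass γ).symm⟩

theorem isQuotientMap_pathClass (X : Type*) [TopologicalSpace X] : IsQuotientMap (pathClass X) :=
  ⟨⟨rfl⟩, pathClass_surjective X⟩

theorem homotopicRel_of_arr_mk_eq {X : Type*} [TopologicalSpace X] {x y x' y' : X}
    {γ : Path x y} {γ' : Path x' y'}
    (h : (⟨⟨x⟩, ⟨y⟩, Path.Homotopic.Quotient.mk γ⟩ : Arr (FundamentalGroupoid X)) =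
      ⟨⟨x'⟩, ⟨y'⟩, Path.Homotopic.Quotient.mk γ'⟩) :
    (γ : C(I, X)).HomotopicRel γ' {0, 1} := by
  obtain rfl : x = x' := congrArg (fun η => η.left.as) h
  obtain rfl : y = y' := congrArg (fun η => η.right.as) h
  obtain h : Path.Homotopic.Quotient.mk γ = Path.Homotopic.Quotient.mk γ' := by
    injection h
  exact Path.Homotopic.Quotient.eq.1 h

theorem pathClass_eq_iff {X : Type*} [TopologicalSpace X] {γ γ' : C(I, X)} :
    pathClass X γ = pathClass X γ' ↔ γ.HomotopicRel γ' {0, 1} := by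
  refine ⟨fun h => homotopicRel_of_arr_mk_eq h, fun h => ?_⟩
  let δ' : Path (γ 0) (γ 1) := ⟨γ', (h.fst_eq_snd (Or.inl rfl)).symm,
    (h.fst_eq_snd (Or.inr rfl)).symm⟩
  rw [show pathClass X γ' = pathClass X δ' from rfl, ← arr_mk_eq_pathClass]
  exact congrArg (fun g => (⟨⟨γ 0⟩, ⟨γ 1⟩, g⟩ : Arr (FundamentalGroupoid X)))
    (Path.Homotopic.Quotient.eq.2 h)

/-- The image of a pair of paths under a continuous map of two variables is homotopic to the
concatenation in which the first variable moves before the second. -/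
theorem homotopic_trans_of_prod {A B Z : Type*} [TopologicalSpace A] [TopologicalSpace B]
    [TopologicalSpace Z] (f : C(A × B, Z)) {a a' : A} {b b' : B} (γ : Path a a') (κ : Path b b')
    {x y z : Z} (p : Path x y) (q : Path y z) (r : Path x z) (hp : ∀ t, p t = f (γ t, b))
    (hq : ∀ t, q t = f (a', κ t)) (hr : ∀ t, r t = f (γ t, κ t)) : r.Homotopic (p.trans q) := by
  obtain rfl : x = f (a, b) := by simpa using hp 0
  obtain rfl : y = f (a', b) := by simpa using hp 1
  obtain rfl : z = f (a', b') := by simpa using hq 1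
  obtain rfl : p = (γ.prod (.refl b)).map f.continuous := Path.ext (funext hp)
  obtain rfl : q = ((Path.refl a').prod κ).map f.continuous := Path.ext (funext hq)
  obtain rfl : r = (γ.prod κ).map f.continuous := Path.ext (funext hr)
  -- In `A × B` the concatenation has coordinates `γ` followed by a rest and a rest followed by `κ`,
  -- which are homotopic to `γ` and `κ`.
  rw [← Path.map_trans, Path.trans_prod_eq_prod_trans]
  exact Path.Homotopic.map
    ⟨Path.Homotopic.prodHomotopy (Path.Homotopy.transRefl γ).symm
      (Path.Homotopy.reflTrans κ).symm⟩ f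

variable {X : Type*} [Group X] [TopologicalSpace X] [IsTopologicalGroup X]

/-- The right translate of a based path, as a path between given end points. -/
def translatePath (γ : basedPaths X) {x y : X} (h : (γ : C(I, X)) 1 * x = y) : Path x y where
  toFun t := (γ : C(I, X)) t * x
  source' := by rw [basedPaths_zero, one_mul]
  target' := h

theorem translatePath_homotopic {γ δ : basedPaths X} {x y : X} (hγ : (γ : C(I, X)) 1 * x = y)
    (hδ : (δ : C(I, X)) 1 * x = y) (h : (γ : UniversalCover X) = δ) :
    Path.Homotopic.Quotient.mk (translatePath γ hγ) =
      Path.Homotopic.Quotient.mk (translatePath δ hδ) :=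
  Path.Homotopic.Quotient.eq.2
    (HomotopicRel.mul (mk_eq_mk_iff.1 h) (.refl (ContinuousMap.const I x)))

variable (X)

/-- The universal covering group acts on `X` by left translation through its projection. -/
abbrev coverAction : MulAction (UniversalCover X) X := MulAction.compHom X (coverProj X)

attribute [local instance] coverAction

variable {X}

theorem continuousSMul_coverAction : ContinuousSMul (UniversalCover X) X :=
  ⟨(continuous_coverProj.comp continuous_fst).mul continuous_snd⟩

/-- A based path representing the label of an arrow. -/
noncomputable def labelPath {x y : ActionCategory (UniversalCover X) X} (g : x ⟶ y) :
    basedPaths X :=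
  (QuotientGroup.mk_surjective
    (arrLabel (⟨x, y, g⟩ : Arr (ActionCategory (UniversalCover X) X)))).choose

theorem mk_labelPath {x y : ActionCategory (UniversalCover X) X} (g : x ⟶ y) :
    (labelPath g : UniversalCover X) =
      arrLabel (⟨x, y, g⟩ : Arr (ActionCategory (UniversalCover X) X)) :=
  (QuotientGroup.mk_surjective
    (arrLabel (⟨x, y, g⟩ : Arr (ActionCategory (UniversalCover X) X)))).choose_spec

theorem endPoint_mul_of_mk_eq {x y : ActionCategory (UniversalCover X) X} (g : x ⟶ y)
    {γ : basedPaths X} (hγ : (γ : UniversalCover X) =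
      arrLabel (⟨x, y, g⟩ : Arr (ActionCategory (UniversalCover X) X))) :
    (γ : C(I, X)) 1 * x.back = y.back := by
  rw [← coverProj_mk, hγ]
  exact label_smul_source (⟨x, y, g⟩ : Arr (ActionCategory (UniversalCover X) X))

/-- The homotopy class of paths attached to an arrow of the transformation groupoid. -/
noncomputable def arrowClass {x y : ActionCategory (UniversalCover X) X} (g : x ⟶ y) :
    Path.Homotopic.Quotient x.back y.back :=
  .mk (translatePath (labelPath g) (endPoint_mul_of_mk_eq g (mk_labelPath g)))

theorem arrowClass_eq {x y : ActionCategory (UniversalCover X) X} (g : x ⟶ y)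
    {γ : basedPaths X} (hγ : (γ : UniversalCover X) =
      arrLabel (⟨x, y, g⟩ : Arr (ActionCategory (UniversalCover X) X))) :
    arrowClass g = .mk (translatePath γ (endPoint_mul_of_mk_eq g hγ)) :=
  translatePath_homotopic _ _ ((mk_labelPath g).trans hγ.symm)

theorem arrowClass_id (x : ActionCategory (UniversalCover X) X) :
    arrowClass (𝟙 x) = .mk (Path.refl x.back) := by
  rw [arrowClass_eq (𝟙 x) (γ := 1) rfl]
  congr 1
  ext t
  exact one_mul _

/-- Eckmann–Hilton: the composite is represented by the pointwise product of the label paths, and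
the map `(a, b) ↦ b * a * x` deforms it into moving `a` along the label of `g` first and `b` along
that of `k` afterwards. -/
theorem arrowClass_comp {x y z : ActionCategory (UniversalCover X) X} (g : x ⟶ y) (k : y ⟶ z) :
    arrowClass (g ≫ k) = (arrowClass g).trans (arrowClass k) := by
  have hmul : ((labelPath k * labelPath g : basedPaths X) : UniversalCover X) =
      arrLabel (⟨x, z, g ≫ k⟩ : Arr (ActionCategory (UniversalCover X) X)) := by
    rw [QuotientGroup.mk_mul, mk_labelPath, mk_labelPath]
    rfl
  rw [arrowClass_eq _ hmul, arrowClass, arrowClass, ← Path.Homotopic.Quotient.mk_trans]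
  refine Path.Homotopic.Quotient.eq.2 (homotopic_trans_of_prod
    (⟨fun p => p.2 * p.1 * x.back, by fun_prop⟩ : C(X × X, X))
    (⟨labelPath g, basedPaths_zero _, rfl⟩ : Path (1 : X) (((labelPath g : C(I, X)) 1)))
    (⟨labelPath k, basedPaths_zero _, rfl⟩ : Path (1 : X) (((labelPath k : C(I, X)) 1)))
    _ _ _ (fun t => ?_) (fun t => ?_) fun t => rfl)
  · change (labelPath g : C(I, X)) t * x.back = 1 * (labelPath g : C(I, X)) t * x.back
    rw [one_mul]
  · change (labelPath k : C(I, X)) t * y.back =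
      (labelPath k : C(I, X)) t * (labelPath g : C(I, X)) 1 * x.back
    rw [mul_assoc, endPoint_mul_of_mk_eq g (mk_labelPath g)]

variable (X) in
/-- The comparison functor from the transformation groupoid of the universal covering group to the
fundamental groupoid. -/
noncomputable def comparison : ActionCategory (UniversalCover X) X ⥤ FundamentalGroupoid X where
  obj x := ⟨x.back⟩
  map g := arrowClass g
  map_id x := arrowClass_id x
  map_comp g k := arrowClass_comp g k

theorem arrMap_comparison (γ : basedPaths X) (x : X) :
    arrMap (comparison X) (transformationArr (γ : UniversalCover X) x) =
      pathClass X (γ * ContinuousMap.const I x) := by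
  refine (congrArg (fun c => (⟨⟨x⟩, ⟨(γ : C(I, X)) 1 * x⟩, c⟩ : Arr (FundamentalGroupoid X)))
    (arrowClass_eq (transformationArr (γ : UniversalCover X) x).hom (γ := γ) rfl)).trans ?_
  exact arr_mk_eq_pathClass (translatePath γ rfl)

variable (X) in
/-- Every path is uniquely the right translate of a based path by its starting point. -/
def pathHomeomorph : basedPaths X × X ≃ₜ C(I, X) where
  toFun p := p.1 * ContinuousMap.const I p.2
  invFun δ := (⟨δ * ContinuousMap.const I (δ 0)⁻¹, mul_inv_cancel (δ 0)⟩, δ 0)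
  left_inv := by
    rintro ⟨γ, x⟩
    have h0 : ((γ : C(I, X)) * ContinuousMap.const I x) 0 = x := by
      rw [ContinuousMap.mul_apply, basedPaths_zero, one_mul, ContinuousMap.const_apply]
    refine Prod.ext (Subtype.ext (ContinuousMap.ext fun t => ?_)) h0
    simp only [h0]
    exact mul_inv_cancel_right _ _
  right_inv δ := ContinuousMap.ext fun t => inv_mul_cancel_right _ _
  continuous_toFun := (continuous_subtype_val.comp continuous_fst).mul
    (ContinuousMap.continuous_const'.comp continuous_snd)
  continuous_invFun := by
    have h0 : Continuous fun δ : C(I, X) => δ 0 := continuous_eval_const 0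
    exact (Continuous.subtype_mk
      (continuous_id.mul (ContinuousMap.continuous_const'.comp h0.inv)) _).prodMk h0

/-- The source recovers `x`; multiplying a homotopy on the right by `x⁻¹` recovers the class of the
based path. -/
theorem injective_arrMap_comparison : Function.Injective (arrMap (comparison X)) := by
  intro a b hab
  obtain ⟨⟨h, x⟩, rfl⟩ := transformationEquiv.symm.surjective a
  obtain ⟨⟨k, y⟩, rfl⟩ := transformationEquiv.symm.surjective b
  obtain ⟨γ, rfl⟩ := QuotientGroup.mk_surjective h
  obtain ⟨δ, rfl⟩ := QuotientGroup.mk_surjective k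
  change arrMap (comparison X) (transformationArr _ _) =
    arrMap (comparison X) (transformationArr _ _) at hab
  obtain rfl : x = y := congrArg (fun η => η.left.as) hab
  rw [arrMap_comparison, arrMap_comparison, pathClass_eq_iff] at hab
  have := HomotopicRel.mul hab (.refl (ContinuousMap.const I x)⁻¹)
  rw [mul_inv_cancel_right, mul_inv_cancel_right, ← mk_eq_mk_iff] at this
  rw [this]

theorem isHomeomorph_arrMap_comparison : IsHomeomorph (arrMap (comparison X)) := by
  let q : basedPaths X × X → Arr (ActionCategory (UniversalCover X) X) :=
    transformationHomeomorph.symm ∘ Prod.map (QuotientGroup.mk (s := nullLoops X)) id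
  -- A product of a quotient map with an identity need not be a quotient map; here it is, since the
  -- projection of a group onto its cosets is open.
  have hq : IsQuotientMap q :=
    transformationHomeomorph.symm.isQuotientMap.comp
      (QuotientGroup.isOpenQuotientMap_mk.prodMap .id).isQuotientMap
  have hcomp : arrMap (comparison X) ∘ q = pathClass X ∘ pathHomeomorph X :=
    funext fun p => arrMap_comparison p.1 p.2
  -- Both arrow spaces are thus quotients of `basedPaths X × X`, and a bijection between them
  -- compatible with the quotient maps is a homeomorphism.
  have hquot : IsQuotientMap (arrMap (comparison X) ∘ q) := by
    rw [hcomp]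
    exact (isQuotientMap_pathClass X).comp (pathHomeomorph X).isQuotientMap
  exact isHomeomorph_iff_isQuotientMap_injective.2
    ⟨.of_comp hq.continuous (hq.continuous_iff.2 hquot.continuous) hquot,
      injective_arrMap_comparison⟩

theorem isTopologicalIso_comparison : IsTopologicalIso (comparison X) where
  isHomeomorph_obj := (unitHomeomorph.trans
    ((FundamentalGroupoid.equiv X).toHomeomorphOfIsInducing ⟨rfl⟩).symm).isHomeomorph
  isHomeomorph_arr := isHomeomorph_arrMap_comparison

end Comparison

end TopGpd

theorem mainTheorem5 (X : Type u) [Group X] [TopologicalSpace X] [IsTopologicalGroup X]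
    [T2Space X] [LocallyCompactSpace X] [PathConnectedSpace X] [LocallyPathConnectedSpace X]
    (hX : SemilocallySimplyConnected X) :
    (IsLocallyCompactGroupoid (FundamentalGroupoid X) ∧
      T2Space (Arr (FundamentalGroupoid X)) ∧
      ∃ α : FundamentalGroupoid X → Measure (Arr (FundamentalGroupoid X)), IsHaarSystem α) ∧
    ∃ (H : Type u) (_ : Group H) (_ : TopologicalSpace H) (_ : MeasurableSpace H)
      (_ : BorelSpace H) (p : H →* X),
      IsUniversalCoveringGroup p ∧ LocallyCompactSpace H ∧ T2Space H ∧
      letI : MulAction H X := MulAction.compHom X p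
      ∃ Φ : ActionCategory H X ⥤ FundamentalGroupoid X,
        IsTopologicalIso Φ ∧ (∀ x : ActionCategory H X, Φ.obj x = ⟨x.back⟩) ∧
        ∀ lam : Measure H, lam.IsHaarMeasure → lam.Regular →
          IsHaarSystem (fun y : FundamentalGroupoid X =>
            (transformationFamily lam y.as).map (arrMap Φ)) := by
  let : MulAction (UniversalCover X) X := coverAction X
  let : MeasurableSpace (UniversalCover X) := borel _
  have : BorelSpace (UniversalCover X) := ⟨rfl⟩
  have : ContinuousSMul (UniversalCover X) X := continuousSMul_coverAction
  have : T2Space (UniversalCover X) := t2Space_universalCover hX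
  have : LocallyCompactSpace (UniversalCover X) := locallyCompactSpace_universalCover hX
  have hΦ : IsTopologicalIso (comparison X) := isTopologicalIso_comparison
  have hHaar (lam : Measure (UniversalCover X)) (_ : lam.IsHaarMeasure) (_ : lam.Regular) :
      IsHaarSystem (fun y : FundamentalGroupoid X =>
        (transformationFamily lam y.as).map (arrMap (comparison X))) :=
    hΦ.isHaarSystem (isHaarSystem_transformationFamily lam) fun _ => rfl
  refine ⟨⟨hΦ.isLocallyCompactGroupoid isLocallyCompactGroupoid_actionCategory, ?_,
    _, hHaar Measure.haar inferInstance inferInstance⟩,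
    UniversalCover X, inferInstance, inferInstance, inferInstance, inferInstance, coverProj X,
    isUniversalCoveringGroup_coverProj hX, inferInstance, inferInstance,
    comparison X, hΦ, fun _ => rfl, hHaar⟩
  -- The arrow space is homeomorphic to the Hausdorff product `H × X`.
  obtain ⟨e, -⟩ := isHomeomorph_iff_exists_homeomorph.1 hΦ.isHomeomorph_arr
  exact (e.symm.trans transformationHomeomorph).isEmbedding.t2Space
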